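/- Let $\mathbb N=\{1,2,3,\dots\}$ and let $c_{00}$ be the real vector space of finitely supported sequences $x:\mathbb N\to\mathbb R$. For $E\subseteq\mathbb N$ let $Ex$ be the restriction of $x$ to $E$ (so $Ex(k)=x(k)$ if $k\in E$ and $Ex(k)=0$ otherwise). A family $(E_i)_{i=1}^n$ of finite non-empty subsets of $\mathbb N$ is called admissible if $n\le \min E_1$ and $\max E_i<\min E_{i+1}$ for $1\le i<n$. Put $\|x\|_0=\|x\|_\infty$ and $$\|x\|_{m+1}=\max\Big(\|x\|_m,\ \sup\Big\{\tfrac12\sum_{i=1}^n\|E_ix\|_m : (E_i)_{i=1}^n\text{ is admissible}\Big\}\Big),\qquad \|x\|=\lim_{m\to\infty}\|x\|_m=\sup_m\|x\|_m .$$ This is a norm on $c_{00}$. Tsirelson's space $\mathbb T$ (in the version of Figiel and Johnson) is the completion of $(c_{00},\|\cdot\|)$. A Banach space $X$, regarded as a bounded metric structure through its closed unit ball $B_X=\{x\in X:\|x\|\le 1\}$, has NIP (the non independence property) if the formula $\phi(x,y)=\|x+y\|$ is NIP on $B_X$, that is: for each sequence $(a_n)$ in $B_X$ and all real numbers $r>s$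 there are finite disjoint sets $P,Q\subseteq\mathbb N$ such that $$\Big\{b\in B_X:\ \|a_n+b\|\le s\ \text{ for all } n\in P,\ \text{ and }\ \|a_n+b\|\ge r\ \text{ for all } n\in Q\Big\}=\emptyset .$$ Corollary. Tsirelson's space $\mathbb T$ has NIP. -/

import Mathlib

/-! ### The Figiel-Johnson norm on finitely supported sequences -/

/-- Admissible families of finite sets of positive integers: `n ≤ E₁ < E₂ < ⋯ < Eₙ`. The sets are
required to be non-empty, as they must be for `min` and `max` to make sense. -/
structure IsAdmissible {n : ℕ} (E : Fin n → Finset ℕ+) : Prop where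
  nonempty : ∀ i, (E i).Nonempty
  le : ∀ i, ∀ k ∈ E i, n ≤ (k : ℕ)
  lt : ∀ i j, i < j → ∀ k ∈ E i, ∀ l ∈ E j, k < l

/-- The restriction `Ex` of a finitely supported sequence `x` to a set `E`. -/
noncomputable def restrictTo (E : Finset ℕ+) (x : ℕ+ →₀ ℝ) : ℕ+ →₀ ℝ :=
  x.filter (fun k => k ∈ E)

/-- The numbers `(1/2) ∑ᵢ N (Eᵢ x)`, for `(Eᵢ)` an admissible family. -/
def admissibleSums (N : (ℕ+ →₀ ℝ) → ℝ) (x : ℕ+ →₀ ℝ) : Set ℝ :=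
  {r | ∃ (n : ℕ) (E : Fin n → Finset ℕ+), IsAdmissible E ∧
    r = 1 / 2 * ∑ i, N (restrictTo (E i) x)}

/-- The approximating norms: `‖x‖₀ = ‖x‖_∞` and
`‖x‖ₘ₊₁ = max (‖x‖ₘ) (sup {(1/2) ∑ᵢ ‖Eᵢ x‖ₘ : (Eᵢ) admissible})`. -/
noncomputable def stageNorm : ℕ → (ℕ+ →₀ ℝ) → ℝ
  | 0 => fun x => ⨆ k, |x k|
  | m + 1 => fun x => max (stageNorm m x) (sSup (admissibleSums (stageNorm m) x))

/-- The Tsirelson norm on `c₀₀`: the supremum, hence the limit, of the bounded increasing sequence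
of the approximating norms. -/
noncomputable def tsirelsonNorm (x : ℕ+ →₀ ℝ) : ℝ := ⨆ m, stageNorm m x

/-! ### The supremums are finite, and the outcome is a norm -/

/-- The `ℓ¹` norm, an upper bound for all the approximating norms. -/
noncomputable def ellOne (x : ℕ+ →₀ ℝ) : ℝ := ∑ k ∈ x.support, |x k|

theorem ellOne_nonneg (x : ℕ+ →₀ ℝ) : 0 ≤ ellOne x :=
  Finset.sum_nonneg fun _ _ => abs_nonneg _

theorem abs_le_ellOne (x : ℕ+ →₀ ℝ) (k : ℕ+) : |x k| ≤ ellOne x := by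
  by_cases hk : k ∈ x.support
  · exact Finset.single_le_sum (f := fun k => |x k|) (fun _ _ => abs_nonneg _) hk
  · rw [Finsupp.notMem_support_iff.mp hk, abs_zero]
    exact ellOne_nonneg x

theorem bddAbove_range_abs (x : ℕ+ →₀ ℝ) : BddAbove (Set.range fun k => |x k|) :=
  ⟨ellOne x, by rintro _ ⟨k, rfl⟩; exact abs_le_ellOne x k⟩

theorem restrictTo_add (E : Finset ℕ+) (x y : ℕ+ →₀ ℝ) :
    restrictTo E (x + y) = restrictTo E x + restrictTo E y := Finsupp.filter_add

theorem restrictTo_smul (E : Finset ℕ+) (c : ℝ) (x : ℕ+ →₀ ℝ) :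
    restrictTo E (c • x) = c • restrictTo E x := Finsupp.filter_smul

theorem ellOne_restrictTo (E : Finset ℕ+) (x : ℕ+ →₀ ℝ) :
    ellOne (restrictTo E x) = ∑ k ∈ x.support, if k ∈ E then |x k| else 0 := by
  rw [ellOne, restrictTo, Finsupp.support_filter, Finset.sum_filter]
  refine Finset.sum_congr rfl fun k _ => ?_
  by_cases h : k ∈ E <;> simp [h]

theorem sum_ellOne_restrictTo_le {n : ℕ} {E : Fin n → Finset ℕ+} (hE : IsAdmissible E)
    (x : ℕ+ →₀ ℝ) : ∑ i, ellOne (restrictTo (E i) x) ≤ ellOne x := by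
  simp only [ellOne_restrictTo]
  rw [Finset.sum_comm, ellOne]
  refine Finset.sum_le_sum fun k _ => ?_
  by_cases h : ∃ i, k ∈ E i
  · obtain ⟨i, hi⟩ := h
    rw [Finset.sum_eq_single i]
    · simp [hi]
    · intro j _ hj
      rw [if_neg]
      intro hk
      rcases lt_or_gt_of_ne hj with h | h
      · exact lt_irrefl _ (hE.lt j i h k hk k hi)
      · exact lt_irrefl _ (hE.lt i j h k hi k hk)
    · simp
  · push Not at h
    simp [h]

theorem zero_mem_admissibleSums (N : (ℕ+ →₀ ℝ) → ℝ) (x : ℕ+ →₀ ℝ) :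
    (0 : ℝ) ∈ admissibleSums N x :=
  ⟨0, Fin.elim0, ⟨fun i => i.elim0, fun i => i.elim0, fun i => i.elim0⟩, by simp⟩

theorem admissibleSums_le {N : (ℕ+ →₀ ℝ) → ℝ} (hN : ∀ x, N x ≤ ellOne x) (x : ℕ+ →₀ ℝ) :
    ∀ r ∈ admissibleSums N x, r ≤ ellOne x := by
  rintro r ⟨n, E, hE, rfl⟩
  have h1 : ∑ i, N (restrictTo (E i) x) ≤ ellOne x :=
    (Finset.sum_le_sum fun i _ => hN _).trans (sum_ellOne_restrictTo_le hE x)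
  linarith [ellOne_nonneg x]

theorem stageNorm_le_ellOne (m : ℕ) : ∀ x, stageNorm m x ≤ ellOne x := by
  induction m with
  | zero => exact fun x => ciSup_le (abs_le_ellOne x)
  | succ m ih =>
    exact fun x => max_le (ih x)
      (csSup_le ⟨0, zero_mem_admissibleSums _ x⟩ (admissibleSums_le ih x))

theorem bddAbove_admissibleSums (m : ℕ) (x : ℕ+ →₀ ℝ) :
    BddAbove (admissibleSums (stageNorm m) x) :=
  ⟨ellOne x, admissibleSums_le (stageNorm_le_ellOne m) x⟩

theorem bddAbove_range_stageNorm (x : ℕ+ →₀ ℝ) : BddAbove (Set.range fun m => stageNorm m x) :=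
  ⟨ellOne x, by rintro _ ⟨m, rfl⟩; exact stageNorm_le_ellOne m x⟩

theorem stageNorm_mono (x : ℕ+ →₀ ℝ) : Monotone fun m => stageNorm m x :=
  monotone_nat_of_le_succ fun _ => le_max_left _ _

theorem abs_le_stageNorm (m : ℕ) (x : ℕ+ →₀ ℝ) (k : ℕ+) : |x k| ≤ stageNorm m x :=
  (le_ciSup (bddAbove_range_abs x) k).trans (stageNorm_mono x (Nat.zero_le m))

theorem stageNorm_add (m : ℕ) : ∀ x y, stageNorm m (x + y) ≤ stageNorm m x + stageNorm m y := by
  induction m with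
  | zero =>
    exact fun x y => ciSup_le fun k => (abs_add_le _ _).trans
      (add_le_add (le_ciSup (bddAbove_range_abs x) k) (le_ciSup (bddAbove_range_abs y) k))
  | succ m ih =>
    intro x y
    refine max_le ((ih x y).trans (add_le_add (le_max_left _ _) (le_max_left _ _))) ?_
    refine csSup_le ⟨0, zero_mem_admissibleSums _ _⟩ ?_
    rintro r ⟨n, E, hE, rfl⟩
    have hx := (le_csSup (bddAbove_admissibleSums m x) ⟨n, E, hE, rfl⟩).trans
      (le_max_right (stageNorm m x) _)
    have hy := (le_csSup (bddAbove_admissibleSums m y) ⟨n, E, hE, rfl⟩).trans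
      (le_max_right (stageNorm m y) _)
    refine le_trans ?_ (add_le_add hx hy)
    rw [← mul_add, ← Finset.sum_add_distrib]
    refine mul_le_mul_of_nonneg_left (Finset.sum_le_sum fun i _ => ?_) (by norm_num)
    rw [restrictTo_add]
    exact ih _ _

theorem stageNorm_smul_le (m : ℕ) :
    ∀ (c : ℝ) (x : ℕ+ →₀ ℝ), stageNorm m (c • x) ≤ |c| * stageNorm m x := by
  induction m with
  | zero =>
    refine fun c x => ciSup_le fun k => ?_
    rw [Finsupp.smul_apply, smul_eq_mul, abs_mul]
    exact mul_le_mul_of_nonneg_left (le_ciSup (bddAbove_range_abs x) k) (abs_nonneg c)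
  | succ m ih =>
    intro c x
    refine max_le ((ih c x).trans
      (mul_le_mul_of_nonneg_left (le_max_left _ _) (abs_nonneg c))) ?_
    refine csSup_le ⟨0, zero_mem_admissibleSums _ _⟩ ?_
    rintro r ⟨n, E, hE, rfl⟩
    have hx := (le_csSup (bddAbove_admissibleSums m x) ⟨n, E, hE, rfl⟩).trans
      (le_max_right (stageNorm m x) _)
    refine le_trans ?_ (mul_le_mul_of_nonneg_left hx (abs_nonneg c))
    rw [mul_left_comm, Finset.mul_sum (a := |c|)]
    refine mul_le_mul_of_nonneg_left (Finset.sum_le_sum fun i _ => ?_) (by norm_num)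
    rw [restrictTo_smul]
    exact ih _ _

theorem abs_le_tsirelsonNorm (x : ℕ+ →₀ ℝ) (k : ℕ+) : |x k| ≤ tsirelsonNorm x :=
  (abs_le_stageNorm 0 x k).trans (le_ciSup (bddAbove_range_stageNorm x) 0)

theorem tsirelsonNorm_nonneg (x : ℕ+ →₀ ℝ) : 0 ≤ tsirelsonNorm x :=
  (abs_nonneg (x 1)).trans (abs_le_tsirelsonNorm x 1)

theorem tsirelsonNorm_add (x y : ℕ+ →₀ ℝ) :
    tsirelsonNorm (x + y) ≤ tsirelsonNorm x + tsirelsonNorm y :=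
  ciSup_le fun m => (stageNorm_add m x y).trans
    (add_le_add (le_ciSup (bddAbove_range_stageNorm x) m)
      (le_ciSup (bddAbove_range_stageNorm y) m))

theorem tsirelsonNorm_smul_le (c : ℝ) (x : ℕ+ →₀ ℝ) :
    tsirelsonNorm (c • x) ≤ |c| * tsirelsonNorm x :=
  ciSup_le fun m => (stageNorm_smul_le m c x).trans
    (mul_le_mul_of_nonneg_left (le_ciSup (bddAbove_range_stageNorm x) m) (abs_nonneg c))

theorem tsirelsonNorm_eq_zero {x : ℕ+ →₀ ℝ} (h : tsirelsonNorm x = 0) : x = 0 := by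
  ext k
  have hk := abs_le_tsirelsonNorm x k
  rw [h] at hk
  exact abs_nonpos_iff.mp hk

theorem tsirelsonNorm_smul (c : ℝ) (x : ℕ+ →₀ ℝ) :
    tsirelsonNorm (c • x) = |c| * tsirelsonNorm x := by
  refine le_antisymm (tsirelsonNorm_smul_le c x) ?_
  rcases eq_or_ne c 0 with rfl | hc
  · simpa using tsirelsonNorm_nonneg _
  · have h := tsirelsonNorm_smul_le c⁻¹ (c • x)
    rw [inv_smul_smul₀ hc, abs_inv] at h
    calc |c| * tsirelsonNorm x ≤ |c| * (|c|⁻¹ * tsirelsonNorm (c • x)) :=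
          mul_le_mul_of_nonneg_left h (abs_nonneg c)
      _ = tsirelsonNorm (c • x) := mul_inv_cancel_left₀ (abs_ne_zero.mpr hc) _

/-! ### Tsirelson's space -/

/-- The real vector space `c₀₀` of finitely supported sequences, to be normed by the Tsirelson
norm. -/
def TsirelsonPre : Type := ℕ+ →₀ ℝ

noncomputable instance : AddCommGroup TsirelsonPre := inferInstanceAs (AddCommGroup (ℕ+ →₀ ℝ))

noncomputable instance : Module ℝ TsirelsonPre := inferInstanceAs (Module ℝ (ℕ+ →₀ ℝ))

noncomputable instance : Norm TsirelsonPre := ⟨tsirelsonNorm⟩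

theorem tsirelsonPre_core : NormedSpace.Core ℝ TsirelsonPre where
  norm_nonneg := tsirelsonNorm_nonneg
  norm_smul := tsirelsonNorm_smul
  norm_triangle := tsirelsonNorm_add
  norm_eq_zero_iff x := by
    refine ⟨tsirelsonNorm_eq_zero, ?_⟩
    rintro rfl
    exact (congrArg tsirelsonNorm (zero_smul ℝ (0 : ℕ+ →₀ ℝ)).symm).trans
      ((tsirelsonNorm_smul 0 0).trans (by simp))

noncomputable instance : NormedAddCommGroup TsirelsonPre :=
  NormedAddCommGroup.ofCore tsirelsonPre_core

noncomputable instance : NormedSpace ℝ TsirelsonPre := NormedSpace.ofCore tsirelsonPre_core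

/-- Tsirelson's space (in the version of Figiel and Johnson): the completion of `c₀₀` for the
Tsirelson norm. It is a real Banach space by the instances on `UniformSpace.Completion`. -/
abbrev TsirelsonSpace : Type := UniformSpace.Completion TsirelsonPre

/-! ### The non independence property -/

/-- A real-valued formula `φ(x, y)` is NIP on the structure with underlying set `M`: for each
sequence `(aₙ)` in `M` and all reals `s < r` there are finite disjoint sets `P`, `Q` of indices
for which no `b ∈ M` has `φ(aₙ, b) ≤ s` for all `n ∈ P` and `φ(aₙ, b) ≥ r` for all `n ∈ Q`. -/
def IsNIPOn {X : Type*} (φ : X → X → ℝ) (M : Set X) : Prop :=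
  ∀ a : ℕ → X, (∀ n, a n ∈ M) → ∀ r s : ℝ, s < r →
    ∃ P Q : Finset ℕ, Disjoint P Q ∧
      {b | b ∈ M ∧ (∀ n ∈ P, φ (a n) b ≤ s) ∧ (∀ n ∈ Q, r ≤ φ (a n) b)} = ∅

/-- A Banach space has NIP if the formula `φ(x, y) = ‖x + y‖` is NIP on it, where the space is
regarded as a (bounded) metric structure through its closed unit ball. -/
def HasNIP (X : Type*) [NormedAddCommGroup X] : Prop :=
  IsNIPOn (fun x y : X => ‖x + y‖) (Metric.closedBall (0 : X) 1)

/-! ### Basic properties of the Tsirelson norm -/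

/-! Along a free ultrafilter, a bounded sequence in c₀₀ is, up to a small error, a fixed vector plus
blocks `u n` whose supports move to infinity (`exists_add_moving`). It remains to compare the norms
of `b + u n` for two well chosen indices `n`.

Let `y` lie to the left of `z`. The norm of `y + z` is computed by nested admissible families, and
at each level only the last set meeting `y` can meet `z` as well. Hence, up to an error that halves
with each level, `y` and `z` interact only through a short list of integers: the numbers of sets to
the right of that last set (`exists_leftVal_rightVal`, `LeftVal.add_le`). These integers are at most
the maximum of the support of `y`, and for a block lying very far out they may be capped at a
smaller bound `p`: restoring the true counts means deleting a few sets from a very long family,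
which costs a small share of its sum (`LeftVal.of_map_min`). So finitely many yes-no data describe a
left part `x₀ + u n`, and the ultrafilter makes them constant in `n`.

Now space the indices widely. Of `K` successive gaps beyond `K`, some gap carries little of `b`,
because these gaps form an admissible family. Up to that small piece, `b` is a part left of the gap
plus a part right of it. Two blocks live inside the gap and have the same data, so exchanging the
first for the second lowers the norm by little (`exists_index_add_le`). Thus no `b` can give large
norms at all even indices and small norms at all odd ones. -/

theorem restrictTo_apply (E : Finset ℕ+) (x : ℕ+ →₀ ℝ) (k : ℕ+) :
    restrictTo E x k = if k ∈ E then x k else 0 := by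
  simp [restrictTo, Finsupp.filter_apply]

theorem restrictTo_restrictTo (E F : Finset ℕ+) (x : ℕ+ →₀ ℝ) :
    restrictTo E (restrictTo F x) = restrictTo (E ∩ F) x := by
  ext k
  by_cases h1 : k ∈ E <;> by_cases h2 : k ∈ F <;> simp [restrictTo_apply, h1, h2]

theorem restrictTo_inter_support (E : Finset ℕ+) (x : ℕ+ →₀ ℝ) :
    restrictTo (E ∩ x.support) x = restrictTo E x := by
  ext k
  by_cases h1 : k ∈ E <;> by_cases h2 : x k = 0 <;> simp [restrictTo_apply, h1, h2]

theorem restrictTo_eq_zero {E : Finset ℕ+} {x : ℕ+ →₀ ℝ} (h : ∀ k ∈ E, x k = 0) :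
    restrictTo E x = 0 := by
  ext k
  by_cases h1 : k ∈ E <;> simp [restrictTo_apply, h1]
  exact h k h1

theorem restrictTo_eq_self {E : Finset ℕ+} {x : ℕ+ →₀ ℝ} (h : x.support ⊆ E) :
    restrictTo E x = x := by
  ext k
  by_cases h1 : k ∈ E
  · simp [restrictTo_apply, h1]
  · have : x k = 0 := Finsupp.notMem_support_iff.mp fun hk => h1 (h hk)
    simp [restrictTo_apply, h1, this]

theorem support_restrictTo_subset (E : Finset ℕ+) (x : ℕ+ →₀ ℝ) :
    (restrictTo E x).support ⊆ x.support := by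
  intro k
  simp only [Finsupp.mem_support_iff, restrictTo_apply]
  split_ifs <;> simp

theorem mem_of_mem_support_restrictTo {E : Finset ℕ+} {x : ℕ+ →₀ ℝ} {k : ℕ+}
    (h : k ∈ (restrictTo E x).support) : k ∈ E := by
  by_contra hk
  simp [restrictTo_apply, hk] at h

theorem tsirelsonNorm_zero : tsirelsonNorm 0 = 0 := by
  simpa using tsirelsonNorm_smul 0 0

theorem tsirelsonNorm_neg (x : ℕ+ →₀ ℝ) : tsirelsonNorm (-x) = tsirelsonNorm x := by
  simpa using tsirelsonNorm_smul (-1) x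

theorem tsirelsonNorm_le_add_sub (x y : ℕ+ →₀ ℝ) :
    tsirelsonNorm x ≤ tsirelsonNorm y + tsirelsonNorm (x - y) := by
  simpa using tsirelsonNorm_add y (x - y)

theorem tsirelsonNorm_sub_comm (x y : ℕ+ →₀ ℝ) :
    tsirelsonNorm (x - y) = tsirelsonNorm (y - x) := by
  rw [← tsirelsonNorm_neg, neg_sub]

theorem tsirelsonNorm_le_ellOne (x : ℕ+ →₀ ℝ) : tsirelsonNorm x ≤ ellOne x :=
  ciSup_le fun m => stageNorm_le_ellOne m x

theorem stageNorm_le_tsirelsonNorm (m : ℕ) (x : ℕ+ →₀ ℝ) : stageNorm m x ≤ tsirelsonNorm x :=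
  le_ciSup (bddAbove_range_stageNorm x) m

theorem stageNorm_restrictTo_le (m : ℕ) :
    ∀ (E : Finset ℕ+) (x : ℕ+ →₀ ℝ), stageNorm m (restrictTo E x) ≤ stageNorm m x := by
  induction m with
  | zero =>
    refine fun E x => ciSup_le fun k => ?_
    refine le_trans ?_ (le_ciSup (bddAbove_range_abs x) k)
    rw [restrictTo_apply]
    split_ifs <;> simp
  | succ m ih =>
    intro E x
    refine max_le ((ih E x).trans (le_max_left _ _)) ?_
    refine csSup_le ⟨0, zero_mem_admissibleSums _ _⟩ ?_
    rintro r ⟨n, F, hF, rfl⟩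
    have hx := (le_csSup (bddAbove_admissibleSums m x) ⟨n, F, hF, rfl⟩).trans
      (le_max_right (stageNorm m x) _)
    refine le_trans ?_ hx
    refine mul_le_mul_of_nonneg_left (Finset.sum_le_sum fun i _ => ?_) (by norm_num)
    rw [restrictTo_restrictTo, Finset.inter_comm, ← restrictTo_restrictTo]
    exact ih _ _

theorem tsirelsonNorm_restrictTo_le (E : Finset ℕ+) (x : ℕ+ →₀ ℝ) :
    tsirelsonNorm (restrictTo E x) ≤ tsirelsonNorm x :=
  ciSup_le fun m => (stageNorm_restrictTo_le m E x).trans (stageNorm_le_tsirelsonNorm m x)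

theorem tendsto_stageNorm (x : ℕ+ →₀ ℝ) :
    Filter.Tendsto (fun m => stageNorm m x) Filter.atTop (nhds (tsirelsonNorm x)) :=
  tendsto_atTop_ciSup (stageNorm_mono x) (bddAbove_range_stageNorm x)

/-- A family applied at stage `m` is dominated by stage `m + 1`; the inequality survives the limit
in `m`. -/
theorem IsAdmissible.half_sum_le {n : ℕ} {E : Fin n → Finset ℕ+} (hE : IsAdmissible E)
    (x : ℕ+ →₀ ℝ) : 1 / 2 * ∑ i, tsirelsonNorm (restrictTo (E i) x) ≤ tsirelsonNorm x := by
  refine le_of_tendsto ((tendsto_finsetSum Finset.univ fun i _ =>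
    tendsto_stageNorm (restrictTo (E i) x)).const_mul (1 / 2)) (Filter.Eventually.of_forall ?_)
  intro m
  exact ((le_csSup (bddAbove_admissibleSums m x) ⟨n, E, hE, rfl⟩).trans
      (le_max_right (stageNorm m x) _)).trans (stageNorm_le_tsirelsonNorm (m + 1) x)

/-! ### Lists of successive sets -/

/-- All elements of `E` are smaller than all elements of `F`. -/
def Before (E F : Finset ℕ+) : Prop := ∀ k ∈ E, ∀ l ∈ F, k < l

theorem Before.mono {E E' F F' : Finset ℕ+} (h : Before E F) (hE : E' ⊆ E) (hF : F' ⊆ F) :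
    Before E' F' := fun k hk l hl => h k (hE hk) l (hF hl)

/-- The sum of the norms of the restrictions of `x` to the members of a list. -/
noncomputable def listNorm (L : List (Finset ℕ+)) (x : ℕ+ →₀ ℝ) : ℝ :=
  (L.map fun E => tsirelsonNorm (restrictTo E x)).sum

@[simp] theorem listNorm_nil (x : ℕ+ →₀ ℝ) : listNorm [] x = 0 := rfl

@[simp] theorem listNorm_cons (E : Finset ℕ+) (L : List (Finset ℕ+)) (x : ℕ+ →₀ ℝ) :
    listNorm (E :: L) x = tsirelsonNorm (restrictTo E x) + listNorm L x := by
  simp [listNorm]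

@[simp] theorem listNorm_append (L M : List (Finset ℕ+)) (x : ℕ+ →₀ ℝ) :
    listNorm (L ++ M) x = listNorm L x + listNorm M x := by
  simp [listNorm]

theorem listNorm_congr {L : List (Finset ℕ+)} {x y : ℕ+ →₀ ℝ}
    (h : ∀ E ∈ L, restrictTo E x = restrictTo E y) : listNorm L x = listNorm L y := by
  rw [listNorm, listNorm, List.map_congr_left fun E hE => by rw [h E hE]]

theorem listNorm_map_inter_support (L : List (Finset ℕ+)) (x : ℕ+ →₀ ℝ) :
    listNorm (L.map (· ∩ x.support)) x = listNorm L x := by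
  simp only [listNorm, List.map_map]
  congr 1
  exact List.map_congr_left fun E _ => by simp [restrictTo_inter_support]

theorem listNorm_filter_nonempty (L : List (Finset ℕ+)) (x : ℕ+ →₀ ℝ) :
    listNorm (L.filter fun E => E.Nonempty) x = listNorm L x := by
  induction L with
  | nil => rfl
  | cons E L ih =>
    rcases Finset.eq_empty_or_nonempty E with rfl | hE
    · rw [List.filter_cons_of_neg (by simp), ih, listNorm_cons,
        restrictTo_eq_zero (by simp), tsirelsonNorm_zero, zero_add]
    · rw [List.filter_cons_of_pos (by simpa using hE), listNorm_cons, listNorm_cons, ih]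

/-- Empty sets are allowed here: deleting them changes no sum and only shortens the family, so
admissibility is kept. -/
theorem half_listNorm_le {L : List (Finset ℕ+)} (hL : L.Pairwise Before)
    (h : ∀ E ∈ L, ∀ k ∈ E, L.length ≤ (k : ℕ)) (x : ℕ+ →₀ ℝ) :
    1 / 2 * listNorm L x ≤ tsirelsonNorm x := by
  rw [← listNorm_filter_nonempty]
  set L' := L.filter fun E => E.Nonempty with hL'
  have hadm : IsAdmissible fun i : Fin L'.length => L'[i] := by
    refine ⟨fun i => ?_, fun i k hk => ?_, fun i j hij => ?_⟩
    · have := (List.mem_filter.mp (List.getElem_mem (l := L') i.2)).2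
      simpa using this
    · have := List.getElem_mem (l := L') i.2
      exact (List.length_filter_le _ _).trans (h _ (List.mem_of_mem_filter this) k hk)
    · exact List.pairwise_iff_getElem.mp (hL.filter _) i j i.2 j.2 hij
  have := hadm.half_sum_le x
  rwa [show ∑ i : Fin L'.length, tsirelsonNorm (restrictTo L'[i] x) = listNorm L' x from
    Fin.sum_univ_fun_getElem L' (fun E => tsirelsonNorm (restrictTo E x))] at this

theorem stageNorm_le_or_exists {δ : ℝ} (hδ : 0 < δ) (x : ℕ+ →₀ ℝ) (m : ℕ) :
    (∃ k, stageNorm m x ≤ |x k| + δ) ∨ ∃ L : List (Finset ℕ+), L.Pairwise Before ∧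
      (∀ E ∈ L, ∀ k ∈ E, L.length ≤ (k : ℕ)) ∧ stageNorm m x ≤ 1 / 2 * listNorm L x + δ := by
  induction m with
  | zero =>
    left
    obtain ⟨k, hk⟩ := exists_lt_of_lt_ciSup (f := fun k => |x k|) (sub_lt_self (stageNorm 0 x) hδ)
    exact ⟨k, by linarith⟩
  | succ m ih =>
    rcases le_total (sSup (admissibleSums (stageNorm m) x)) (stageNorm m x) with h | h
    · have : stageNorm (m + 1) x = stageNorm m x := max_eq_left h
      rwa [this]
    · right
      have he : stageNorm (m + 1) x = sSup (admissibleSums (stageNorm m) x) := max_eq_right h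
      obtain ⟨_, ⟨n, E, hE, rfl⟩, hr⟩ :=
        exists_lt_of_lt_csSup ⟨0, zero_mem_admissibleSums (stageNorm m) x⟩ (sub_lt_self _ hδ)
      refine ⟨List.ofFn E, ?_, ?_, ?_⟩
      · rw [List.pairwise_ofFn]
        exact fun i j hij => hE.lt i j hij
      · intro F hF k hk
        obtain ⟨i, rfl⟩ := (List.mem_ofFn' E F).mp hF
        simpa using hE.le i k hk
      · have : ∑ i, stageNorm m (restrictTo (E i) x) ≤ listNorm (List.ofFn E) x := by
          rw [listNorm, List.map_ofFn, List.sum_ofFn]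
          exact Finset.sum_le_sum fun i _ => stageNorm_le_tsirelsonNorm _ _
        rw [he]
        linarith

/-- The implicit equation of Figiel and Johnson, up to a positive error. -/
theorem tsirelsonNorm_le_or_exists {δ : ℝ} (hδ : 0 < δ) (x : ℕ+ →₀ ℝ) :
    (∃ k, tsirelsonNorm x ≤ |x k| + δ) ∨ ∃ L : List (Finset ℕ+), L.Pairwise Before ∧
      (∀ E ∈ L, ∀ k ∈ E, L.length ≤ (k : ℕ)) ∧ tsirelsonNorm x ≤ 1 / 2 * listNorm L x + δ := by
  obtain ⟨m, hm⟩ := exists_lt_of_lt_ciSup (sub_lt_self (tsirelsonNorm x) (half_pos hδ))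
  rcases stageNorm_le_or_exists (half_pos hδ) x m with ⟨k, hk⟩ | ⟨L, h1, h2, h3⟩
  · exact Or.inl ⟨k, by linarith⟩
  · exact Or.inr ⟨L, h1, h2, by linarith⟩

/-! ### Splitting the norm of a sum `y + z` with `y` to the left of `z` -/

/-- `LeftVal c ks y v`: the part `y` of a vector `y + z`, with `y` to the left of `z`, contributes
at least `v` to the norm through iterated admissible families for which the numbers of sets to the
right of the one which meets both `y` and `z` are given by the list `ks`. At the innermost level
there is a set that meets only `y` (for `c = true`) or only `z` (for `c = false`). -/
def LeftVal (c : Bool) : List ℕ → (ℕ+ →₀ ℝ) → ℝ → Prop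
  | [], y, v => v ≤ if c then tsirelsonNorm y else 0
  | k :: ks, y, v => ∃ (L : List (Finset ℕ+)) (G : Finset ℕ+) (v₀ : ℝ),
      (L ++ [G]).Pairwise Before ∧
      (∀ E ∈ L ++ [G], E ⊆ y.support ∧ ∀ e ∈ E, L.length + 1 + k ≤ (e : ℕ)) ∧
      LeftVal c ks (restrictTo G y) v₀ ∧ v ≤ 1 / 2 * (listNorm L y + v₀)

/-- The analogue of `LeftVal` for the right part `z`. -/
def RightVal (c : Bool) : List ℕ → (ℕ+ →₀ ℝ) → ℝ → Prop
  | [], z, w => w ≤ if c then 0 else tsirelsonNorm z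
  | k :: ks, z, w => ∃ (G : Finset ℕ+) (M : List (Finset ℕ+)) (w₀ : ℝ),
      (G :: M).Pairwise Before ∧ M.length = k ∧ (∀ E ∈ G :: M, E ⊆ z.support) ∧
      RightVal c ks (restrictTo G z) w₀ ∧ w ≤ 1 / 2 * (w₀ + listNorm M z)

theorem LeftVal.mono {c : Bool} {ks : List ℕ} {y : ℕ+ →₀ ℝ} {v v' : ℝ}
    (h : LeftVal c ks y v) (hv : v' ≤ v) : LeftVal c ks y v' := by
  cases ks with
  | nil => exact hv.trans h
  | cons k ks =>
    obtain ⟨L, G, v₀, h1, h2, h3, h4⟩ := h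
    exact ⟨L, G, v₀, h1, h2, h3, hv.trans h4⟩

/-- Fewer sets on the right weaken the size requirement on the left sets. -/
theorem LeftVal.map_min {c : Bool} (p : ℕ) {ks : List ℕ} :
    ∀ {y : ℕ+ →₀ ℝ} {v : ℝ}, LeftVal c ks y v → LeftVal c (ks.map (min p)) y v := by
  induction ks with
  | nil => exact fun h => h
  | cons k ks ih =>
    rintro y v ⟨L, G, v₀, h1, h2, h3, h4⟩
    refine ⟨L, G, v₀, h1, fun E hE => ⟨(h2 E hE).1, fun e he => ?_⟩, ih h3, h4⟩
    have := (h2 E hE).2 e he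
    have := min_le_right p k
    omega

theorem LeftVal.le {c : Bool} {ks : List ℕ} :
    ∀ {y : ℕ+ →₀ ℝ} {v : ℝ}, LeftVal c ks y v → v ≤ tsirelsonNorm y := by
  induction ks with
  | nil =>
    intro y v h
    refine le_trans h ?_
    split_ifs
    · exact le_rfl
    · exact tsirelsonNorm_nonneg y
  | cons k ks ih =>
    rintro y v ⟨L, G, v₀, h1, h2, h3, h4⟩
    have h5 := half_listNorm_le h1
      (fun E hE e he => by have := (h2 E hE).2 e he; simp; omega) y
    have := ih h3
    simp only [listNorm_append, listNorm_cons, listNorm_nil] at h5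
    linarith

/-- The hypothesis on `ks` makes `G :: M`, a family of `k + 1` sets, admissible without any help
from the left. -/
theorem RightVal.le {c : Bool} {ks : List ℕ} :
    ∀ {z : ℕ+ →₀ ℝ} {w : ℝ}, (∀ k ∈ ks, ∀ e ∈ z.support, k + 1 ≤ (e : ℕ)) →
      RightVal c ks z w → w ≤ tsirelsonNorm z := by
  induction ks with
  | nil =>
    intro z w _ h
    refine le_trans h ?_
    split_ifs
    · exact tsirelsonNorm_nonneg z
    · exact le_rfl
  | cons k ks ih =>
    rintro z w hks ⟨G, M, w₀, h1, rfl, h2, h3, h4⟩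
    have h5 := half_listNorm_le h1 (fun E hE e he => by
      have := hks _ List.mem_cons_self e (h2 E hE he)
      simpa using this) z
    have := ih (fun k hk e he => hks k (List.mem_cons_of_mem _ hk) e
      (support_restrictTo_subset _ _ he)) h3
    simp only [listNorm_cons] at h5
    linarith

theorem restrictTo_support_add {y z : ℕ+ →₀ ℝ} (h : Before y.support z.support) :
    restrictTo y.support (y + z) = y ∧ restrictTo z.support (y + z) = z := by
  rw [restrictTo_add, restrictTo_add, restrictTo_eq_self subset_rfl,
    restrictTo_eq_self (x := z) subset_rfl, restrictTo_eq_zero, restrictTo_eq_zero]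
  · simp
  · intro k hk
    by_contra h'
    exact lt_irrefl _ (h k (by simpa using h') k hk)
  · intro k hk
    by_contra h'
    exact lt_irrefl _ (h k hk k (by simpa using h'))

theorem restrictTo_add_of_subset_left {y z : ℕ+ →₀ ℝ} (h : Before y.support z.support)
    {E : Finset ℕ+} (hE : E ⊆ y.support) : restrictTo E (y + z) = restrictTo E y := by
  conv_rhs => rw [← (restrictTo_support_add h).1]
  rw [restrictTo_restrictTo, Finset.inter_eq_left.mpr hE]

theorem restrictTo_add_of_subset_right {y z : ℕ+ →₀ ℝ} (h : Before y.support z.support)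
    {E : Finset ℕ+} (hE : E ⊆ z.support) : restrictTo E (y + z) = restrictTo E z := by
  conv_rhs => rw [← (restrictTo_support_add h).2]
  rw [restrictTo_restrictTo, Finset.inter_eq_left.mpr hE]

/-- At each level the two families are glued by merging `G` and `G'` into one set. The count
`L.length + 1 + k` in `LeftVal` is exactly the length of the glued family. -/
theorem LeftVal.add_le {c : Bool} {ks : List ℕ} :
    ∀ {y z : ℕ+ →₀ ℝ} {v w : ℝ}, Before y.support z.support →
      (∀ k ∈ ks, ∀ e ∈ z.support, k + 1 ≤ (e : ℕ)) →
      LeftVal c ks y v → RightVal c ks z w → v + w ≤ tsirelsonNorm (y + z) := by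
  induction ks with
  | nil =>
    intro y z v w hyz _ hv hw
    have h1 := tsirelsonNorm_restrictTo_le y.support (y + z)
    have h2 := tsirelsonNorm_restrictTo_le z.support (y + z)
    rw [(restrictTo_support_add hyz).1] at h1
    rw [(restrictTo_support_add hyz).2] at h2
    cases c <;> simp only [LeftVal, RightVal, if_true, if_false, Bool.false_eq_true] at hv hw <;>
      linarith
  | cons k ks ih =>
    intro y z v w hyz hks hv hw
    have hw' := hw.le hks
    have hz := tsirelsonNorm_restrictTo_le z.support (y + z)
    rw [(restrictTo_support_add hyz).2] at hz
    obtain ⟨L, G, v₀, f1, f2, f3, f4⟩ := hv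
    obtain ⟨G', M, w₀, g1, rfl, g3, g4, g5⟩ := hw
    -- A point of a left set is at least the total count, and all of `z` lies beyond that point, so
    -- the right sets meet the size requirement too.
    by_cases hne : ∃ E ∈ L ++ [G], E.Nonempty
    · have hl : ∀ e ∈ z.support, L.length + 1 + M.length ≤ (e : ℕ) := by
        obtain ⟨E, hE, e, he⟩ := hne
        intro e' he'
        have h1 := (f2 E hE).2 e he
        have h2 : (e : ℕ) < e' := hyz e ((f2 E hE).1 he) e' he'
        omega
      have hLy : ∀ E ∈ L, E ⊆ y.support := fun E hE => (f2 E (by simp [hE])).1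
      have hGy : G ⊆ y.support := (f2 G (by simp)).1
      have hMz : ∀ E ∈ M, E ⊆ z.support := fun E hE => g3 E (by simp [hE])
      have hGz : G' ⊆ z.support := g3 G' (by simp)
      rw [List.pairwise_append] at f1
      rw [List.pairwise_cons] at g1
      have key := half_listNorm_le (L := L ++ (G ∪ G') :: M) (by
        rw [List.pairwise_append, List.pairwise_cons]
        refine ⟨f1.1, ⟨fun F hF => ?_, g1.2⟩, fun E hE F hF => ?_⟩
        · intro a ha b hb
          rcases Finset.mem_union.mp ha with ha | ha
          · exact hyz a (hGy ha) b (hMz F hF hb)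
          · exact g1.1 F hF a ha b hb
        · intro a ha b hb
          rcases List.mem_cons.mp hF with rfl | hF
          · rcases Finset.mem_union.mp hb with hb | hb
            · exact f1.2.2 E hE G (by simp) a ha b hb
            · exact hyz a (hLy E hE ha) b (hGz hb)
          · exact hyz a (hLy E hE ha) b (hMz F hF hb)) (by
        intro E hE e he
        simp only [List.length_append, List.length_cons]
        simp only [List.mem_append, List.mem_cons] at hE
        rcases hE with hE | rfl | hE
        · have := (f2 E (by simp [hE])).2 e he
          omega
        · rcases Finset.mem_union.mp he with he | he
          · have := (f2 G (by simp)).2 e he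
            omega
          · have := hl e (hGz he)
            omega
        · have := hl e (hMz E hE he)
          omega) (y + z)
      have h1 : listNorm L (y + z) = listNorm L y :=
        listNorm_congr fun E hE => restrictTo_add_of_subset_left hyz (hLy E hE)
      have h2 : listNorm M (y + z) = listNorm M z :=
        listNorm_congr fun E hE => restrictTo_add_of_subset_right hyz (hMz E hE)
      have h3 : restrictTo (G ∪ G') (y + z) = restrictTo G y + restrictTo G' z := by
        rw [← restrictTo_add_of_subset_left hyz hGy, ← restrictTo_add_of_subset_right hyz hGz]
        ext k
        have hd : k ∈ G → k ∉ G' := fun h h' => lt_irrefl _ (hyz k (hGy h) k (hGz h'))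
        by_cases hk : k ∈ G
        · simp [restrictTo_apply, hk, hd hk]
        · by_cases hk' : k ∈ G' <;> simp [restrictTo_apply, hk, hk']
      have h4 := ih (y := restrictTo G y) (z := restrictTo G' z)
        (hyz.mono (support_restrictTo_subset _ _) (support_restrictTo_subset _ _))
        (fun k hk e he => hks k (List.mem_cons_of_mem _ hk) e
          (support_restrictTo_subset _ _ he)) f3 g4
      rw [listNorm_append, listNorm_cons, h1, h2, h3] at key
      linarith
    -- With all left sets empty, `v ≤ 0`, and `w` is bounded by the norm of `z` alone.
    · push Not at hne
      have h1 : listNorm L y = 0 := by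
        rw [listNorm]
        refine List.sum_eq_zero fun r hr => ?_
        obtain ⟨E, hE, rfl⟩ := List.mem_map.mp hr
        rw [hne E (by simp [hE]), restrictTo_eq_zero (by simp), tsirelsonNorm_zero]
      have h2 := f3.le
      rw [hne G (by simp), restrictTo_eq_zero (by simp), tsirelsonNorm_zero] at h2
      linarith

theorem exists_last_of_exists {α : Type*} (P : α → Prop) :
    ∀ L : List α, (∃ a ∈ L, P a) → ∃ A a B, L = A ++ a :: B ∧ P a ∧ ∀ b ∈ B, ¬ P b := by
  intro L
  induction L with
  | nil => simp
  | cons a L ih =>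
    intro h
    by_cases hL : ∃ a ∈ L, P a
    · obtain ⟨A, a', B, rfl, h2, h3⟩ := ih hL
      exact ⟨a :: A, a', B, rfl, h2, h3⟩
    · push Not at hL
      obtain ⟨b, hb, hPb⟩ := h
      rcases List.mem_cons.mp hb with rfl | hb
      · exact ⟨[], b, L, rfl, hPb, hL⟩
      · exact absurd hPb (hL b hb)

/-- A nearly optimal family for `y + z` is split at the last set meeting `y`, and only the
restriction to that set needs a further decomposition. The factor 1/2 at each level halves the
remaining error. -/
theorem exists_leftVal_rightVal {C δ : ℝ} (hδ : 0 < δ) (t : ℕ) :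
    ∀ y z : ℕ+ →₀ ℝ, Before y.support z.support → tsirelsonNorm y ≤ C →
      ∃ (c : Bool) (ks : List ℕ) (v w : ℝ), ks.length ≤ t ∧
        (∀ k ∈ ks, ∃ e ∈ y.support, k ≤ (e : ℕ)) ∧ 0 ≤ v ∧ LeftVal c ks y v ∧
        RightVal c ks z w ∧ tsirelsonNorm (y + z) ≤ v + w + C / 2 ^ t + 2 * δ := by
  induction t with
  | zero =>
    intro y z _ hC
    -- At depth zero `y` is simply discarded, at a cost of at most `C`.
    refine ⟨false, [], 0, tsirelsonNorm z, by simp, by simp, le_rfl, by simp [LeftVal],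
      by simp [RightVal], ?_⟩
    have := tsirelsonNorm_add y z
    simp
    linarith
  | succ t ih =>
    intro y z hyz hC
    have hC0 : 0 ≤ C / 2 ^ (t + 1) := div_nonneg ((tsirelsonNorm_nonneg y).trans hC) (by positivity)
    have left (h : tsirelsonNorm (y + z) ≤ tsirelsonNorm y + δ) :
        ∃ (c : Bool) (ks : List ℕ) (v w : ℝ), ks.length ≤ t + 1 ∧
        (∀ k ∈ ks, ∃ e ∈ y.support, k ≤ (e : ℕ)) ∧ 0 ≤ v ∧ LeftVal c ks y v ∧
        RightVal c ks z w ∧ tsirelsonNorm (y + z) ≤ v + w + C / 2 ^ (t + 1) + 2 * δ :=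
      ⟨true, [], tsirelsonNorm y, 0, by simp, by simp, tsirelsonNorm_nonneg y, by simp [LeftVal],
        by simp [RightVal], by linarith⟩
    have right (h : tsirelsonNorm (y + z) ≤ tsirelsonNorm z + δ) :
        ∃ (c : Bool) (ks : List ℕ) (v w : ℝ), ks.length ≤ t + 1 ∧
        (∀ k ∈ ks, ∃ e ∈ y.support, k ≤ (e : ℕ)) ∧ 0 ≤ v ∧ LeftVal c ks y v ∧
        RightVal c ks z w ∧ tsirelsonNorm (y + z) ≤ v + w + C / 2 ^ (t + 1) + 2 * δ :=
      ⟨false, [], 0, tsirelsonNorm z, by simp, by simp, le_rfl, by simp [LeftVal],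
        by simp [RightVal], by linarith⟩
    rcases tsirelsonNorm_le_or_exists hδ (y + z) with ⟨k, hk⟩ | ⟨L, h1, h2, h3⟩
    · by_cases hy : k ∈ y.support
      · apply left
        have hz : z k = 0 := by
          by_contra h
          exact lt_irrefl _ (hyz k hy k (by simpa using h))
        rw [Finsupp.add_apply, hz, add_zero] at hk
        linarith [abs_le_tsirelsonNorm y k]
      · apply right
        rw [Finsupp.add_apply, Finsupp.notMem_support_iff.mp hy, zero_add] at hk
        linarith [abs_le_tsirelsonNorm z k]
    · by_cases hne : ∃ E ∈ L, (E ∩ y.support).Nonempty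
      · obtain ⟨A, G, B, rfl, ⟨g, hg⟩, hB⟩ := exists_last_of_exists _ L hne
        rw [Finset.mem_inter] at hg
        rw [List.pairwise_append, List.pairwise_cons] at h1
        have hA (E) (hE : E ∈ A) : restrictTo E (y + z) = restrictTo E y := by
          rw [restrictTo_add, restrictTo_eq_zero (x := z), add_zero]
          intro k hk
          by_contra h
          exact lt_asymm (h1.2.2 E hE G (by simp) k hk g hg.1)
            (hyz g hg.2 k (by simpa using h))
        have hB' (E) (hE : E ∈ B) : restrictTo E (y + z) = restrictTo E z := by
          rw [restrictTo_add, restrictTo_eq_zero (x := y), zero_add]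
          intro k hk
          by_contra h
          exact hB E hE ⟨k, Finset.mem_inter.mpr ⟨hk, by simpa using h⟩⟩
        obtain ⟨c, ks, v, w, i1, i2, i3, i4, i5, i6⟩ := ih (restrictTo G y) (restrictTo G z)
          (hyz.mono (support_restrictTo_subset _ _) (support_restrictTo_subset _ _))
          ((tsirelsonNorm_restrictTo_le _ _).trans hC)
        refine ⟨c, B.length :: ks, 1 / 2 * (listNorm A y + v), 1 / 2 * (w + listNorm B z),
          by simpa using i1, ?_, ?_, ?_, ?_, ?_⟩
        · intro k hk
          rcases List.mem_cons.mp hk with rfl | hk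
          -- Since `g` lies in a set of the family, the length of the whole family, hence that of
          -- `B`, is at most `g`.
          · refine ⟨g, hg.2, ?_⟩
            have := h2 G (by simp) g hg.1
            simp at this
            omega
          · obtain ⟨e, he, hke⟩ := i2 k hk
            exact ⟨e, support_restrictTo_subset _ _ he, hke⟩
        · have : 0 ≤ listNorm A y := List.sum_nonneg fun r hr => by
            obtain ⟨E, _, rfl⟩ := List.mem_map.mp hr
            exact tsirelsonNorm_nonneg _
          linarith
        · refine ⟨A.map (· ∩ y.support), G ∩ y.support, v, ?_, ?_, ?_, ?_⟩
          · have : A.map (· ∩ y.support) ++ [G ∩ y.support] = (A ++ [G]).map (· ∩ y.support) := by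
              simp
            rw [this, List.pairwise_map, List.pairwise_append]
            refine ⟨h1.1.imp fun h => h.mono Finset.inter_subset_left Finset.inter_subset_left,
              by simp, fun E hE F hF => ?_⟩
            rw [List.mem_singleton] at hF
            subst hF
            exact (h1.2.2 E hE F (by simp)).mono Finset.inter_subset_left Finset.inter_subset_left
          · intro E hE
            simp only [List.mem_append, List.mem_map, List.mem_singleton] at hE
            have : ∃ F ∈ A ++ G :: B, E = F ∩ y.support := by
              rcases hE with ⟨F, hF, rfl⟩ | rfl
              · exact ⟨F, by simp [hF], rfl⟩
              · exact ⟨G, by simp, rfl⟩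
            obtain ⟨F, hF, rfl⟩ := this
            refine ⟨Finset.inter_subset_right, fun e he => ?_⟩
            have := h2 F hF e (Finset.mem_inter.mp he).1
            simp at this ⊢
            omega
          · rwa [restrictTo_inter_support]
          · rw [listNorm_map_inter_support]
        · refine ⟨G ∩ z.support, B.map (· ∩ z.support), w, ?_, by simp, ?_, ?_, ?_⟩
          · have : (G ∩ z.support) :: B.map (· ∩ z.support) = (G :: B).map (· ∩ z.support) := by
              simp
            rw [this, List.pairwise_map, List.pairwise_cons]
            exact ⟨fun E hE => (h1.2.1.1 E hE).mono Finset.inter_subset_left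
              Finset.inter_subset_left, h1.2.1.2.imp fun h => h.mono Finset.inter_subset_left
              Finset.inter_subset_left⟩
          · intro E hE
            simp only [List.mem_cons, List.mem_map] at hE
            rcases hE with rfl | ⟨F, _, rfl⟩ <;> exact Finset.inter_subset_right
          · rwa [restrictTo_inter_support]
          · rw [listNorm_map_inter_support]
        · rw [listNorm_append, listNorm_cons, listNorm_congr hA, listNorm_congr hB',
            restrictTo_add] at h3
          -- The other error reproduces itself: half of `2 * δ`, plus the new `δ`.
          have : C / 2 ^ (t + 1) = 1 / 2 * (C / 2 ^ t) := by rw [pow_succ]; ring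
          linarith
      · apply right
        push Not at hne
        have : listNorm L (y + z) = listNorm L z := listNorm_congr fun E hE => by
          rw [restrictTo_add, restrictTo_eq_zero (x := y), zero_add]
          intro k hk
          by_contra h
          have : k ∈ E ∩ y.support := Finset.mem_inter.mpr ⟨hk, by simpa using h⟩
          rw [hne E hE] at this
          simp at this
        rw [this] at h3
        linarith [half_listNorm_le h1 h2 z]

/-! ### Restoring capped counts by deleting sets -/

/-- Some `k` terms of a sum of non-negative numbers amount to no more than their share. -/
theorem exists_sublist_sum {α : Type*} (f : α → ℝ) (L : List α) (k : ℕ) (hk : k ≤ L.length) :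
    ∃ L' : List α, L'.Sublist L ∧ L'.length + k = L.length ∧
      (L.map f).sum * L'.length ≤ (L'.map f).sum * L.length := by
  induction k with
  | zero => exact ⟨L, List.Sublist.refl L, rfl, le_rfl⟩
  | succ k ih =>
    obtain ⟨L', h1, h2, h3⟩ := ih (by omega)
    -- Some term is at most the average; it is the one to delete.
    have hex : ∃ a ∈ L', f a * L'.length ≤ (L'.map f).sum := by
      by_contra! h
      have hpos : (0 : ℝ) < L'.length := by
        have : 0 < L'.length := by omega
        exact_mod_cast this
      have hlt : (L'.map fun _ => (L'.map f).sum / L'.length).sum < (L'.map f).sum := by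
        refine List.sum_lt_sum_of_ne_nil (by rintro rfl; simp at hpos) _ _ fun a ha => ?_
        rw [div_lt_iff₀ hpos]
        exact h a ha
      rw [List.map_const', List.sum_replicate, nsmul_eq_mul, mul_div_cancel₀ _ hpos.ne'] at hlt
      exact lt_irrefl _ hlt
    obtain ⟨a, ha, hle⟩ := hex
    obtain ⟨A, B, rfl⟩ := List.append_of_mem ha
    refine ⟨A ++ B, ((List.sublist_cons_self a B).append_left A).trans h1, by simp at h2 ⊢; omega, ?_⟩
    simp only [List.map_append, List.map_cons, List.sum_append, List.sum_cons, List.length_append,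
      List.length_cons, Nat.cast_add, Nat.cast_one] at h3 hle ⊢
    have hn : (0 : ℝ) ≤ L.length := by positivity
    set m : ℝ := A.length + B.length with hm
    have hm0 : 0 ≤ m := by positivity
    have e : (A.length : ℝ) + (B.length + 1) = m + 1 := by ring
    rw [e] at h3 hle
    set s := (A.map f).sum + (B.map f).sum with hs
    have e2 : (A.map f).sum + (f a + (B.map f).sum) = s + f a := by ring
    rw [e2] at h3 hle
    have h4 : f a * m ≤ s := by linarith
    have h5 := mul_le_mul_of_nonneg_right h4 hn
    have h6 := mul_le_mul_of_nonneg_right h3 hm0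
    have h7 : (L.map f).sum * m * (m + 1) ≤ s * L.length * (m + 1) := by nlinarith
    exact le_of_mul_le_mul_right h7 (by linarith)

/-- A count `k > p` that was capped forces the left sets beyond `p`, hence beyond `R`. Either there
is room for the true count, or the family is so long that deleting `k` of its sets costs at most
`η`. The loss does not accumulate over levels, as `(η + η) / 2 = η`. -/
theorem LeftVal.of_map_min {c : Bool} {p q R : ℕ} {C η : ℝ} (hη : 0 ≤ η) (hR : 2 * q + 1 ≤ R)
    (hCR : 2 * C * q ≤ η * (R - q)) {ks : List ℕ} :
    ∀ {y : ℕ+ →₀ ℝ} {v : ℝ}, (∀ e ∈ y.support, p < (e : ℕ) → R ≤ (e : ℕ)) →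
      tsirelsonNorm y ≤ C → (∀ k ∈ ks, k ≤ q) →
      LeftVal c (ks.map (min p)) y v → LeftVal c ks y (v - η) := by
  induction ks with
  | nil => exact fun _ _ _ h => LeftVal.mono h (by linarith)
  | cons k ks ih =>
    rintro y v hy hC hks ⟨L, G, v₀, h1, h2, h3, h4⟩
    have h5 := ih (y := restrictTo G y) (fun e he => hy e (support_restrictTo_subset _ _ he))
      ((tsirelsonNorm_restrictTo_le _ _).trans hC) (fun k hk => hks k (List.mem_cons_of_mem _ hk)) h3
    have hkq := hks k List.mem_cons_self
    rcases le_total k p with hkp | hkp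
    · rw [min_eq_right hkp] at h2
      exact ⟨L, G, _, h1, h2, h5, by linarith⟩
    rw [min_eq_left hkp] at h2
    have hRe : ∀ E ∈ L ++ [G], ∀ e ∈ E, R ≤ (e : ℕ) := fun E hE e he =>
      hy e ((h2 E hE).1 he) (by have := (h2 E hE).2 e he; omega)
    by_cases hlen : L.length + 1 + k ≤ R
    · exact ⟨L, G, _, h1, fun E hE => ⟨(h2 E hE).1, fun e he => hlen.trans (hRe E hE e he)⟩, h5,
        by linarith⟩
    -- Here `L` has at least `R - q` members and total at most `2 * C`; deleting `k` of them frees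
    -- exactly the room for `k` sets on the right.
    obtain ⟨L', hs, hl, hsum⟩ :=
      exists_sublist_sum (fun E => tsirelsonNorm (restrictTo E y)) L k (by omega)
    have hsub : (L' ++ [G]).Sublist (L ++ [G]) := hs.append_right _
    refine ⟨L', G, _, h1.sublist hsub, fun E hE => ⟨(h2 E (hsub.subset hE)).1, fun e he => ?_⟩,
      h5, ?_⟩
    · have := (h2 E (hsub.subset hE)).2 e he
      omega
    · have h6 := half_listNorm_le (List.pairwise_append.mp h1).1 (fun E hE e he => by
        have := (h2 E (by simp [hE])).2 e he
        omega) y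
      change listNorm L y * _ ≤ listNorm L' y * _ at hsum
      have hl' : (L'.length : ℝ) = L.length - k := by
        rw [← hl]; push_cast; ring
      rw [hl'] at hsum
      have hlR : (R : ℝ) - q ≤ L.length := by
        have : R ≤ L.length + q := by omega
        have : (R : ℝ) ≤ L.length + q := by exact_mod_cast this
        linarith
      have hkq' : (k : ℝ) ≤ q := by exact_mod_cast hkq
      have hpos : (0 : ℝ) < L.length := by
        have : 0 < L.length := by omega
        exact_mod_cast this
      have hC0 : 0 ≤ C := (tsirelsonNorm_nonneg y).trans hC
      have h7 : listNorm L y * k ≤ η * L.length := calc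
        listNorm L y * k ≤ (2 * C) * q :=
          mul_le_mul (by linarith) hkq' (by positivity) (by positivity)
        _ ≤ η * (R - q) := hCR
        _ ≤ η * L.length := mul_le_mul_of_nonneg_left hlR hη
      have h8 : (listNorm L y - η) * L.length ≤ listNorm L' y * L.length := by linarith
      have h9 := le_of_mul_le_mul_right h8 hpos
      linarith

/-! ### Cutting sequences at natural numbers -/

/-- The positive integers in the interval `[M, N)`. -/
def natSegment (M N : ℕ) : Finset ℕ+ := Finset.subtype (fun k => 0 < k) (Finset.Ico M N)

theorem mem_natSegment {M N : ℕ} {k : ℕ+} : k ∈ natSegment M N ↔ M ≤ (k : ℕ) ∧ (k : ℕ) < N := by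
  unfold natSegment
  exact Finset.mem_subtype.trans Finset.mem_Ico

/-- The `K` segments start at or after `K`, so they are admissible, and their average is at most
twice the norm over `K`. -/
theorem exists_tsirelsonNorm_restrictTo_natSegment_le {N : ℕ → ℕ} (hN : StrictMono N) {K : ℕ}
    (hK : 0 < K) (hKN : K ≤ N 0) (x : ℕ+ →₀ ℝ) :
    ∃ j < K, tsirelsonNorm (restrictTo (natSegment (N j) (N (j + 1))) x) ≤
      2 * tsirelsonNorm x / K := by
  by_contra! h
  have hE : IsAdmissible fun i : Fin K => natSegment (N i) (N (i + 1)) := by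
    refine ⟨fun i => ?_, fun i k hk => ?_, fun i j hij k hk l hl => ?_⟩
    · have : 0 < N i := (hK.trans_le hKN).trans_le (hN.monotone (Nat.zero_le _))
      exact ⟨⟨N i, this⟩, mem_natSegment.mpr ⟨le_rfl, hN (Nat.lt_succ_self _)⟩⟩
    · exact (hKN.trans (hN.monotone (Nat.zero_le _))).trans (mem_natSegment.mp hk).1
    · have h1 : N (i + 1) ≤ N j := hN.monotone hij
      exact_mod_cast ((mem_natSegment.mp hk).2.trans_le h1).trans_le (mem_natSegment.mp hl).1
  have h1 := hE.half_sum_le x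
  have h2 : ∑ _i : Fin K, 2 * tsirelsonNorm x / K <
      ∑ i : Fin K, tsirelsonNorm (restrictTo (natSegment (N i) (N (i + 1))) x) :=
    Finset.sum_lt_sum_of_nonempty ⟨⟨0, hK⟩, Finset.mem_univ _⟩ fun i _ => h i i.2
  rw [Finset.sum_const, Finset.card_univ, Fintype.card_fin, nsmul_eq_mul,
    mul_div_cancel₀ _ (by positivity)] at h2
  linarith

theorem ellOne_le_sum {x : ℕ+ →₀ ℝ} {s : Finset ℕ+} (h : x.support ⊆ s) :
    ellOne x ≤ ∑ k ∈ s, |x k| :=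
  Finset.sum_le_sum_of_subset_of_nonneg h fun _ _ _ => abs_nonneg _

/-- Bounded sets of vectors with support in a given finite set are totally bounded. -/
theorem exists_finite_net (s : Finset ℕ+) (C : ℝ) {ε : ℝ} (hε : 0 < ε) :
    ∃ F : Set (ℕ+ →₀ ℝ), F.Finite ∧ (∀ x ∈ F, x.support ⊆ s) ∧
      ∀ x : ℕ+ →₀ ℝ, x.support ⊆ s → tsirelsonNorm x ≤ C →
        ∃ x₀ ∈ F, tsirelsonNorm (x - x₀) ≤ ε := by
  classical
  set ρ : ℝ := ε / (s.card + 1) with hρ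
  have hρ0 : 0 < ρ := by positivity
  obtain ⟨T, -, hT, hcover⟩ :=
    (isCompact_closedBall (0 : s → ℝ) |C|).finite_cover_balls hρ0
  let g : (s → ℝ) → (ℕ+ →₀ ℝ) := fun f =>
    Finsupp.onFinset s (fun k => if h : k ∈ s then f ⟨k, h⟩ else 0) (by
      intro k hk
      by_contra h
      simp [h] at hk)
  refine ⟨g '' T, hT.image g, ?_, ?_⟩
  · rintro _ ⟨f, -, rfl⟩
    exact Finsupp.support_onFinset_subset
  · intro x hx hC
    have hmem : (fun k : s => x k) ∈ Metric.closedBall (0 : s → ℝ) |C| := by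
      rw [mem_closedBall_zero_iff, pi_norm_le_iff_of_nonneg (abs_nonneg C)]
      exact fun k => ((abs_le_tsirelsonNorm x k).trans hC).trans (le_abs_self C)
    obtain ⟨f, hf, hxf⟩ := Set.mem_iUnion₂.mp (hcover hmem)
    refine ⟨g f, ⟨f, hf, rfl⟩, (tsirelsonNorm_le_ellOne _).trans ?_⟩
    have hsupp : (x - g f).support ⊆ s :=
      (Finsupp.support_sub).trans (Finset.union_subset hx Finsupp.support_onFinset_subset)
    refine (ellOne_le_sum hsupp).trans ?_
    calc ∑ k ∈ s, |(x - g f) k| ≤ ∑ _k ∈ s, ρ := by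
          refine Finset.sum_le_sum fun k hk => ?_
          have := (dist_le_pi_dist (fun k : s => x k) f ⟨k, hk⟩).trans (Metric.mem_ball.mp hxf).le
          simpa [g, hk, Real.dist_eq] using this
      _ = s.card * ρ := by rw [Finset.sum_const, nsmul_eq_mul]
      _ ≤ ε := by
          rw [hρ, mul_div_assoc', div_le_iff₀ (by positivity)]
          nlinarith

/-! ### Block sequences -/

theorem eventually_iff_eventually (U : Ultrafilter ℕ) (P : ℕ → Prop) :
    ∀ᶠ n in (U : Filter ℕ), P n ↔ ∀ᶠ m in (U : Filter ℕ), P m := by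
  by_cases h : ∀ᶠ m in (U : Filter ℕ), P m
  · filter_upwards [h] with n hn
    exact ⟨fun _ => h, fun _ => hn⟩
  · filter_upwards [Ultrafilter.eventually_not.mpr h] with n hn
    exact ⟨fun h' => absurd h' hn, fun h' => absurd h' h⟩

theorem finite_lists (t p : ℕ) : {ks : List ℕ | ks.length ≤ t ∧ ∀ k ∈ ks, k ≤ p}.Finite := by
  refine ((List.finite_length_le (Fin (p + 1)) t).image (List.map Fin.val)).subset ?_
  rintro ks ⟨h1, h2⟩
  refine ⟨ks.map (Fin.ofNat (p + 1)), by simpa using h1, ?_⟩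
  rw [List.map_map]
  conv_rhs => rw [← List.map_id ks]
  refine List.map_congr_left fun k hk => ?_
  simp [Nat.mod_eq_of_lt (Nat.lt_succ_of_le (h2 k hk))]

/-- A comparison of the norms of `y + z` and `y' + z` from the left parts. -/
theorem tsirelsonNorm_add_le_of_leftVal {p q R t m : ℕ} {C ε : ℝ} (hε : 0 < ε)
    (ht : C / 2 ^ t ≤ ε) (hm : C ≤ ε * m) (hR : 2 * q + 1 ≤ R) (hCR : 2 * C * q ≤ ε * (R - q))
    {y y' z : ℕ+ →₀ ℝ} (hyz : Before y.support z.support) (hyz' : Before y'.support z.support)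
    (hy : tsirelsonNorm y ≤ C) (hy' : tsirelsonNorm y' ≤ C) (hyq : ∀ e ∈ y.support, (e : ℕ) ≤ q)
    (hyR : ∀ e ∈ y'.support, p < (e : ℕ) → R ≤ (e : ℕ)) (hz : ∀ e ∈ z.support, q < (e : ℕ))
    (h : ∀ (c : Bool) (ks : List ℕ), ks.length ≤ t → (∀ k ∈ ks, k ≤ p) → ∀ i ≤ m,
      LeftVal c ks y (ε * i) → LeftVal c ks y' (ε * i)) :
    tsirelsonNorm (y + z) ≤ tsirelsonNorm (y' + z) + 5 * ε := by
  obtain ⟨c, ks, v, w, h1, h2, h3, h4, h5, h6⟩ := exists_leftVal_rightVal hε t y z hyz hy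
  have hksq : ∀ k ∈ ks, k ≤ q := fun k hk => by
    obtain ⟨e, he, hke⟩ := h2 k hk
    exact hke.trans (hyq e he)
  -- Rounding `v` down to the grid `ε * i`, `i ≤ m`, leaves finitely many values to test.
  set i := ⌊v / ε⌋₊ with hi
  have hi1 : ε * i ≤ v := by
    have := Nat.floor_le (div_nonneg h3 hε.le)
    rw [le_div_iff₀ hε] at this
    linarith
  have hi2 : v ≤ ε * i + ε := by
    have := (Nat.lt_floor_add_one (v / ε)).le
    rw [div_le_iff₀ hε] at this
    linarith
  have him : i ≤ m := by
    have : ε * i ≤ ε * m := (hi1.trans (h4.le.trans hy)).trans hm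
    exact_mod_cast le_of_mul_le_mul_left this hε
  have h7 := h c (ks.map (min p)) (by simpa using h1) (by simp) i him
    ((h4.mono hi1).map_min p)
  have h8 := h7.of_map_min hε.le hR hCR hyR hy' hksq
  have h9 := h8.add_le hyz' (fun k hk e he => (Nat.succ_le_succ (hksq k hk)).trans (hz e he)) h5
  -- The five errors: one from the depth `t`, two from near-optimal families, one from rounding, one
  -- from restoring the counts.
  linarith

/-- The bound `K` is independent of `b`, so finitely many pairs of indices serve all `b` at once. -/
theorem exists_index_add_le {U : Ultrafilter ℕ} (hU : ∀ M, ∀ᶠ n in (U : Filter ℕ), M ≤ n)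
    {u : ℕ → ℕ+ →₀ ℝ} {D : ℕ → Prop} (hD : ∀ᶠ n in (U : Filter ℕ), D n) {C : ℝ}
    (hC : ∀ n, tsirelsonNorm (u n) ≤ C)
    (hu : ∀ M : ℕ, ∀ᶠ n in (U : Filter ℕ), ∀ e ∈ (u n).support, M ≤ (e : ℕ)) (C' : ℝ) {ε : ℝ}
    (hε : 0 < ε) :
    ∃ φ : ℕ → ℕ, StrictMono φ ∧ (∀ i, D (φ i)) ∧ ∃ K, ∀ b, tsirelsonNorm b ≤ C' →
      ∃ j < K, tsirelsonNorm (b + u (φ (2 * j))) ≤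
        tsirelsonNorm (b + u (φ (2 * j + 1))) + 9 * ε := by
  have hC0 : 0 ≤ C := (tsirelsonNorm_nonneg _).trans (hC 0)
  set B : ℝ := |C'| + ε + C with hB
  have hB0 : 0 ≤ B := by positivity
  obtain ⟨t, ht⟩ : ∃ t : ℕ, B / 2 ^ t ≤ ε := by
    obtain ⟨t, ht⟩ := pow_unbounded_of_one_lt (B / ε) (one_lt_two (α := ℝ))
    refine ⟨t, ?_⟩
    rw [div_lt_iff₀ hε] at ht
    rw [div_le_iff₀ (by positivity)]
    linarith
  obtain ⟨m, hm⟩ : ∃ m : ℕ, B ≤ ε * m := by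
    obtain ⟨m, hm⟩ := exists_nat_ge (B / ε)
    exact ⟨m, by rwa [div_le_iff₀' hε] at hm⟩
  have hgap (q : ℕ) : ∃ R : ℕ, 2 * q + 1 ≤ R ∧ 2 * B * q ≤ ε * (R - q) := by
    obtain ⟨r, hr⟩ := exists_nat_ge (2 * B * q / ε)
    refine ⟨r + (2 * q + 1), by omega, ?_⟩
    rw [div_le_iff₀' hε] at hr
    refine hr.trans (mul_le_mul_of_nonneg_left ?_ hε.le)
    push_cast
    have : (0 : ℝ) ≤ q := by positivity
    linarith
  choose R hR1 hR2 using hgap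
  choose F hFfin hFsupp hFnet using fun p => exists_finite_net (natSegment 0 p) C' hε
  have hA (p : ℕ) : ∀ᶠ n in (U : Filter ℕ), ∀ b ∈ F p, ∀ c : Bool,
      ∀ ks ∈ {ks : List ℕ | ks.length ≤ t ∧ ∀ k ∈ ks, k ≤ p}, ∀ i ∈ Set.Iic m,
        (LeftVal c ks (b + u n) (ε * i) ↔
          ∀ᶠ n' in (U : Filter ℕ), LeftVal c ks (b + u n') (ε * i)) := by
    rw [Filter.eventually_all_finite (hFfin p)]
    intro b _
    rw [Filter.eventually_all]
    intro c
    rw [Filter.eventually_all_finite (finite_lists t p)]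
    intro ks _
    rw [Filter.eventually_all_finite (Set.finite_Iic m)]
    exact fun i _ => eventually_iff_eventually U fun n => LeftVal c ks (b + u n) (ε * i)
  -- The index `n N` has its block beyond `R N` and already shows the limiting data for every net `F
  -- p` with `p ≤ N`.
  have hG (N : ℕ) := ((hD.and (hU N)).and ((hu (R N)).and
    ((Filter.eventually_all_finite (Set.finite_Iic N)).mpr fun p _ => hA p))).exists
  choose n hn using hG
  have hnext (N : ℕ) : ∃ N', N < N' ∧ n N < N' ∧ ∀ e ∈ (u (n N)).support, (e : ℕ) < N' := by
    refine ⟨N + n N + (u (n N)).support.sup (fun e => (e : ℕ)) + 1, by omega, by omega,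
      fun e he => ?_⟩
    have := Finset.le_sup (f := fun e : ℕ+ => (e : ℕ)) he
    omega
  choose f hf1 hf2 hf3 using hnext
  obtain ⟨K, hK⟩ := exists_nat_gt (2 * |C'| / ε)
  have hKpos : (0 : ℝ) < K := lt_of_le_of_lt (by positivity) hK
  have hK0 : 0 < K := by exact_mod_cast hKpos
  set N : ℕ → ℕ := fun i => f^[i] K with hN
  have hNs (i : ℕ) : N (i + 1) = f (N i) := Function.iterate_succ_apply' f i K
  have hNmono : StrictMono N := strictMono_nat_of_lt_succ fun i => by rw [hNs]; exact hf1 _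
  refine ⟨fun i => n (N i), strictMono_nat_of_lt_succ fun i => ?_, fun i => (hn _).1.1, K,
    fun b hb => ?_⟩
  · have h1 := hf2 (N i)
    have h2 := (hn (N (i + 1))).1.2
    rw [hNs] at h2 ⊢
    omega
  have hb' : tsirelsonNorm b ≤ |C'| := hb.trans (le_abs_self _)
  -- Gaps run over two steps of `N`, to hold the blocks of both `n (N (2 * j))` and `n (N (2 * j +
  -- 1))`.
  obtain ⟨j, hj, hjb⟩ := exists_tsirelsonNorm_restrictTo_natSegment_le (N := fun j => N (2 * j))
    (fun i j hij => hNmono (by omega)) hK0 le_rfl b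
  refine ⟨j, hj, ?_⟩
  have hsmall : tsirelsonNorm (restrictTo (natSegment (N (2 * j)) (N (2 * (j + 1)))) b) ≤ ε := by
    refine hjb.trans ?_
    rw [div_lt_iff₀ hε] at hK
    rw [div_le_iff₀ hKpos]
    linarith
  have e1 : 2 * (j + 1) = 2 * j + 1 + 1 := by ring
  rw [e1] at hsmall
  set p := N (2 * j) with hp
  set q := N (2 * j + 1) with hq
  set r := N (2 * j + 1 + 1) with hr
  have hqp : q = f p := hNs _
  have hrq : r = f q := hNs _
  have hpq : p < q := hNmono (by omega)
  have hqr : q < r := hNmono (by omega)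
  set x := restrictTo (natSegment 0 p) b with hx
  set z := restrictTo (b.support \ natSegment 0 r) b with hz
  have hsplit : b = x + restrictTo (natSegment p r) b + z := by
    ext k
    have hk : k ∈ b.support \ natSegment 0 r ↔ b k ≠ 0 ∧ r ≤ (k : ℕ) := by
      simp [mem_natSegment]
    simp only [hx, hz, Finsupp.add_apply, restrictTo_apply, mem_natSegment, hk]
    by_cases h0 : b k = 0
    · simp [h0]
    · rcases lt_or_ge (k : ℕ) p with h1 | h1
      · have h2 : ¬ p ≤ (k : ℕ) := by omega
        have h3 : ¬ r ≤ (k : ℕ) := by omega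
        simp [h1, h2, h3]
      · have h1' : ¬ (k : ℕ) < p := by omega
        rcases lt_or_ge (k : ℕ) r with h2 | h2
        · have h3 : ¬ r ≤ (k : ℕ) := by omega
          simp [h1, h1', h2, h3]
        · have h3 : ¬ (k : ℕ) < r := by omega
          simp [h0, h1', h2, h3]
  obtain ⟨x₀, hx₀F, hx₀⟩ := hFnet p x (fun k hk => mem_of_mem_support_restrictTo hk)
    ((tsirelsonNorm_restrictTo_le _ _).trans hb)
  have hx₀p : ∀ e ∈ x₀.support, (e : ℕ) < p := fun e he =>
    (mem_natSegment.mp (hFsupp p x₀ hx₀F he)).2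
  have hzr : ∀ e ∈ z.support, r ≤ (e : ℕ) := fun e he => by
    have := mem_of_mem_support_restrictTo he
    simp [mem_natSegment] at this
    exact this.2
  have hx₀B : tsirelsonNorm x₀ ≤ |C'| + ε := by
    have h1 := tsirelsonNorm_le_add_sub x₀ x
    rw [tsirelsonNorm_sub_comm] at h1
    linarith [(tsirelsonNorm_restrictTo_le (natSegment 0 p) b).trans hb']
  have hyB (k : ℕ) : tsirelsonNorm (x₀ + u k) ≤ B :=
    (tsirelsonNorm_add _ _).trans (by linarith [hC k])
  have hsup (k : ℕ) (e : ℕ+) (he : e ∈ (x₀ + u k).support) :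
      e ∈ x₀.support ∨ e ∈ (u k).support := Finset.mem_union.mp (Finsupp.support_add he)
  have hup (e : ℕ+) (he : e ∈ (x₀ + u (n p)).support) : (e : ℕ) < q := by
    rcases hsup _ e he with h | h
    · exact (hx₀p e h).trans hpq
    · rw [hqp]
      exact hf3 p e h
  have huq (e : ℕ+) (he : e ∈ (x₀ + u (n q)).support) : (e : ℕ) < r := by
    rcases hsup _ e he with h | h
    · exact ((hx₀p e h).trans hpq).trans hqr
    · rw [hrq]
      exact hf3 q e h
  have main := tsirelsonNorm_add_le_of_leftVal (p := p) (q := q) (z := z) hε ht hm (hR1 q) (hR2 q)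
    (fun k hk l hl => by exact_mod_cast ((hup k hk).trans hqr).trans_le (hzr l hl))
    (fun k hk l hl => by exact_mod_cast (huq k hk).trans_le (hzr l hl))
    (hyB (n p)) (hyB (n q)) (fun e he => (hup e he).le)
    (fun e he hpe => by
      rcases hsup _ e he with h | h
      · have := hx₀p e h
        omega
      · exact (hn q).2.1 e h)
    (fun e he => hqr.trans_le (hzr e he))
    -- Both indices agree with the ultrafilter limit on lists bounded by `p`, so the data pass from
    -- one block to the other.
    (fun c ks h1 h2 i hi h3 => ((hn q).2.2 p hpq.le x₀ hx₀F c ks ⟨h1, h2⟩ i hi).mpr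
      (((hn p).2.2 p (Set.mem_Iic.mpr le_rfl) x₀ hx₀F c ks ⟨h1, h2⟩ i hi).mp h3))
  have hclose (k : ℕ) : tsirelsonNorm (b + u k - (x₀ + u k + z)) ≤ 2 * ε := by
    have : b + u k - (x₀ + u k + z) = (x - x₀) + restrictTo (natSegment p r) b := by
      conv_lhs => rw [hsplit]
      abel
    rw [this]
    linarith [tsirelsonNorm_add (x - x₀) (restrictTo (natSegment p r) b)]
  have h1 := tsirelsonNorm_le_add_sub (b + u (n p)) (x₀ + u (n p) + z)
  have h2 := tsirelsonNorm_le_add_sub (x₀ + u (n q) + z) (b + u (n q))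
  rw [tsirelsonNorm_sub_comm (x₀ + u (n q) + z)] at h2
  -- `5 * ε` from the comparison and `2 * ε` for each replacement of `b` by `x₀ + z`.
  linarith [hclose (n p), hclose (n q)]

/-! ### A constant part and a moving part of a bounded sequence -/

theorem exists_tail_restrictTo_le (U : Ultrafilter ℕ) {a : ℕ → ℕ+ →₀ ℝ} {C ε : ℝ} (hε : 0 < ε)
    (ha : ∀ n, tsirelsonNorm (a n) ≤ C) :
    ∃ N, ∀ M, ∀ᶠ n in (U : Filter ℕ), tsirelsonNorm (restrictTo (natSegment N M) (a n)) ≤ ε := by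
  by_contra! h
  choose g hg using h
  have hlt (N : ℕ) : N < g N := by
    by_contra! h
    obtain ⟨n, hn⟩ := (hg N).exists
    rw [restrictTo_eq_zero, tsirelsonNorm_zero] at hn
    · exact lt_asymm hε hn
    · intro k hk
      have := mem_natSegment.mp hk
      omega
  obtain ⟨K, hK⟩ := exists_nat_gt (2 * C / ε)
  have hC0 : 0 ≤ C := (tsirelsonNorm_nonneg _).trans (ha 0)
  have hKpos : (0 : ℝ) < K := lt_of_le_of_lt (by positivity) hK
  have hK0 : 0 < K := by exact_mod_cast hKpos
  set N : ℕ → ℕ := fun i => g^[i] K with hN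
  have hNs (i : ℕ) : N (i + 1) = g (N i) := Function.iterate_succ_apply' g i K
  have hNmono : StrictMono N := strictMono_nat_of_lt_succ fun i => by rw [hNs]; exact hlt _
  -- A single `a n` is large on `K` successive segments, which the segment estimate forbids for
  -- large `K`.
  obtain ⟨n, hn⟩ :=
    ((Filter.eventually_all_finite (Set.finite_Iio K)).mpr fun j _ => hg (N j)).exists
  obtain ⟨j, hj, hjn⟩ := exists_tsirelsonNorm_restrictTo_natSegment_le hNmono hK0 le_rfl (a n)
  have h1 := hn j hj
  rw [← hNs] at h1
  have h2 := h1.trans_le hjn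
  rw [lt_div_iff₀ hKpos] at h2
  rw [div_lt_iff₀ hε] at hK
  linarith [ha n]

/-- Along an ultrafilter a bounded sequence is, up to a small error, the sum of a constant sequence
and a sequence whose supports move to infinity. -/
theorem exists_add_moving {U : Ultrafilter ℕ} (hU : ∀ M, ∀ᶠ n in (U : Filter ℕ), M ≤ n)
    {a : ℕ → ℕ+ →₀ ℝ} {C ε : ℝ} (hε : 0 < ε) (ha : ∀ n, tsirelsonNorm (a n) ≤ C) :
    ∃ (x : ℕ+ →₀ ℝ) (u : ℕ → ℕ+ →₀ ℝ), (∀ n, tsirelsonNorm (u n) ≤ C) ∧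
      (∀ M : ℕ, ∀ᶠ n in (U : Filter ℕ), ∀ e ∈ (u n).support, M ≤ (e : ℕ)) ∧
      ∀ᶠ n in (U : Filter ℕ), tsirelsonNorm (a n - (x + u n)) ≤ 2 * ε := by
  classical
  obtain ⟨N, hN⟩ := exists_tail_restrictTo_le U hε ha
  obtain ⟨F, hF, -, hFnet⟩ := exists_finite_net (natSegment 0 N) C hε
  obtain ⟨x, -, hx⟩ : ∃ x ∈ F, ∀ᶠ n in (U : Filter ℕ),
      tsirelsonNorm (restrictTo (natSegment 0 N) (a n) - x) ≤ ε :=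
    (Ultrafilter.eventually_exists_mem_iff hF).mp (Filter.Eventually.of_forall fun n =>
      hFnet _ (fun k hk => mem_of_mem_support_restrictTo hk)
        ((tsirelsonNorm_restrictTo_le _ _).trans (ha n)))
  set P : ℕ → ℕ → Prop := fun n M =>
    tsirelsonNorm (restrictTo (natSegment N M) (a n)) ≤ ε with hP
  -- Diagonal choice: the segment up to `m n` is negligible for `a n`, yet `m n` tends to infinity
  -- along `U`.
  set m : ℕ → ℕ := fun n => Nat.findGreatest (P n) n with hm
  have hP0 (n : ℕ) : P n 0 := by
    have : restrictTo (natSegment N 0) (a n) = 0 := restrictTo_eq_zero fun k hk => by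
      have := mem_natSegment.mp hk
      omega
    simp only [hP, this, tsirelsonNorm_zero]
    exact hε.le
  have hPm (n : ℕ) : P n (m n) := Nat.findGreatest_spec (Nat.zero_le n) (hP0 n)
  have hmU (M : ℕ) : ∀ᶠ n in (U : Filter ℕ), M ≤ m n := by
    filter_upwards [hU M, hN M] with n h1 h2
    exact Nat.le_findGreatest h1 h2
  refine ⟨x, fun n => restrictTo ((a n).support \ natSegment 0 (m n)) (a n),
    fun n => (tsirelsonNorm_restrictTo_le _ _).trans (ha n), fun M => ?_, ?_⟩
  · filter_upwards [hmU M] with n hn e he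
    have := mem_of_mem_support_restrictTo he
    simp [mem_natSegment] at this
    omega
  · filter_upwards [hmU N, hx] with n hn hxn
    have : a n - (x + restrictTo ((a n).support \ natSegment 0 (m n)) (a n)) =
        (restrictTo (natSegment 0 N) (a n) - x) + restrictTo (natSegment N (m n)) (a n) := by
      have hsplit : a n = restrictTo (natSegment 0 N) (a n) + restrictTo (natSegment N (m n)) (a n)
          + restrictTo ((a n).support \ natSegment 0 (m n)) (a n) := by
        ext k
        have hk : k ∈ (a n).support \ natSegment 0 (m n) ↔ a n k ≠ 0 ∧ m n ≤ (k : ℕ) := by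
          simp [mem_natSegment]
        simp only [Finsupp.add_apply, restrictTo_apply, mem_natSegment, hk]
        by_cases h0 : a n k = 0
        · simp [h0]
        · grind
      rw [sub_eq_iff_eq_add]
      refine hsplit.trans ?_
      abel
    rw [this]
    refine (tsirelsonNorm_add _ _).trans ?_
    have := hPm n
    simp only [hP] at this
    linarith

/-! ### From finitely supported vectors to the completion -/

theorem norm_add_sub_coe_le {a b : TsirelsonSpace} {x y : TsirelsonPre} {ε : ℝ}
    (ha : ‖a - x‖ ≤ ε) (hb : ‖b - y‖ ≤ ε) :
    |‖a + b‖ - tsirelsonNorm ((x + y : TsirelsonPre) : ℕ+ →₀ ℝ)| ≤ 2 * ε := by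
  have h1 : tsirelsonNorm ((x + y : TsirelsonPre) : ℕ+ →₀ ℝ) =
      ‖((x + y : TsirelsonPre) : TsirelsonSpace)‖ :=
    (UniformSpace.Completion.norm_coe (x + y)).symm
  rw [h1]
  refine (abs_norm_sub_norm_le _ _).trans ?_
  rw [UniformSpace.Completion.coe_add, add_sub_add_comm]
  exact (norm_add_le _ _).trans (by linarith)

theorem exists_coe_norm_sub_le (a : TsirelsonSpace) {ε : ℝ} (hε : 0 < ε) :
    ∃ x : TsirelsonPre, ‖a - x‖ ≤ ε := by
  obtain ⟨x, hx⟩ := UniformSpace.Completion.denseRange_coe.exists_dist_lt a hε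
  exact ⟨x, by rw [← dist_eq_norm]; exact hx.le⟩

theorem tsirelsonNorm_le_of_norm_sub_le {a : TsirelsonSpace} {x : TsirelsonPre} {ε : ℝ}
    (ha : ‖a‖ ≤ 1) (h : ‖a - x‖ ≤ ε) : tsirelsonNorm x ≤ 1 + ε := by
  have h1 : tsirelsonNorm x = ‖(x : TsirelsonSpace)‖ :=
    (UniformSpace.Completion.norm_coe x).symm
  rw [h1]
  have := norm_sub_norm_le (x : TsirelsonSpace) a
  rw [norm_sub_rev] at this
  linarith

theorem mainTheorem5 : HasNIP TsirelsonSpace := by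
  intro a ha r s hsr
  -- The total error will be `9 * ε` plus two approximations of `4 * ε`, that is `17 * ε`, just
  -- below `r - s`.
  set ε : ℝ := (r - s) / 18 with hε'
  have hε : 0 < ε := by
    have := sub_pos.mpr hsr
    positivity
  choose x hx using fun n => exists_coe_norm_sub_le (a n) hε
  have hxC (n : ℕ) : tsirelsonNorm (x n) ≤ 1 + ε :=
    tsirelsonNorm_le_of_norm_sub_le (mem_closedBall_zero_iff.mp (ha n)) (hx n)
  have hU (M : ℕ) : ∀ᶠ n in (Filter.hyperfilter ℕ : Filter ℕ), M ≤ n :=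
    Nat.hyperfilter_le_atTop (Filter.eventually_ge_atTop M)
  obtain ⟨α, u, huC, hu, hxu⟩ := exists_add_moving hU (a := x) hε hxC
  obtain ⟨φ, hφ, hφD, K, hK⟩ :=
    exists_index_add_le hU hxu huC hu (1 + ε + tsirelsonNorm α) hε
  refine ⟨(Finset.range K).image fun j => φ (2 * j + 1), (Finset.range K).image fun j => φ (2 * j),
    ?_, ?_⟩
  · rw [Finset.disjoint_left]
    intro i hi hi'
    obtain ⟨j, -, rfl⟩ := Finset.mem_image.mp hi
    obtain ⟨j', -, hj'⟩ := Finset.mem_image.mp hi'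
    have := hφ.injective hj'
    omega
  · rw [Set.eq_empty_iff_forall_notMem]
    rintro b ⟨hb, hbP, hbQ⟩
    obtain ⟨y, hy⟩ := exists_coe_norm_sub_le b hε
    have hyC := tsirelsonNorm_le_of_norm_sub_le (mem_closedBall_zero_iff.mp hb) hy
    let y' : ℕ+ →₀ ℝ := y
    obtain ⟨j, hj, hle⟩ := hK (y' + α) ((tsirelsonNorm_add _ _).trans (by
      change tsirelsonNorm y + _ ≤ _
      linarith))
    have hP : ‖a (φ (2 * j + 1)) + b‖ ≤ s :=
      hbP _ (Finset.mem_image.mpr ⟨j, Finset.mem_range.mpr hj, rfl⟩)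
    have hQ : r ≤ ‖a (φ (2 * j)) + b‖ :=
      hbQ _ (Finset.mem_image.mpr ⟨j, Finset.mem_range.mpr hj, rfl⟩)
    have hclose (i : ℕ) : |‖a (φ i) + b‖ - tsirelsonNorm (y' + α + u (φ i))| ≤ 4 * ε := by
      let x' : ℕ+ →₀ ℝ := x (φ i)
      have h1 : |‖a (φ i) + b‖ - tsirelsonNorm (x' + y')| ≤ 2 * ε :=
        norm_add_sub_coe_le (hx (φ i)) hy
      have h2 : tsirelsonNorm (x' - (α + u (φ i))) ≤ 2 * ε := hφD i
      have h3 : x' + y' - (y' + α + u (φ i)) = x' - (α + u (φ i)) := by abel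
      have h4 := tsirelsonNorm_le_add_sub (x' + y') (y' + α + u (φ i))
      have h5 := tsirelsonNorm_le_add_sub (y' + α + u (φ i)) (x' + y')
      rw [tsirelsonNorm_sub_comm, h3] at h5
      rw [h3] at h4
      rw [abs_le] at h1 ⊢
      constructor <;> linarith [h1.1, h1.2]
    have h1 := (abs_le.mp (hclose (2 * j))).2
    have h2 := (abs_le.mp (hclose (2 * j + 1))).1
    have : r - s = 18 * ε := by rw [hε']; ring
    linarith
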